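/- **Theorem 1 (Convex Formulation).** Let $N\ge 1$ and let $\boldsymbol\xi^i=(\boldsymbol x^i,\boldsymbol z^i,y^i)$, $i\in[N]=\{1,\dots,N\}$, be points of $\Xi=\mathbb R^n\times\mathcal C\times\{-1,+1\}$, where $\mathcal C=\mathcal C_1\times\dots\times\mathcal C_m$ and $\mathcal C_\ell=\{\boldsymbol z\in\{0,1\}^{a_\ell-1}:\sum_k z_k\le 1\}$ is the set of one-hot encodings of a categorical feature with $a_\ell\ge 1$ values; let $c=\sum_{\ell}(a_\ell-1)$. For $\boldsymbol\beta=(\beta_0,\boldsymbol\beta_{\rm x},\boldsymbol\beta_{\rm z})\in\mathbb R^{1+n+c}$ let $$l_{\boldsymbol\beta}(\boldsymbol x,\boldsymbol z,y)=\log\bigl(1+\exp(-y(\beta_0+\boldsymbol\beta_{\rm x}^\top\boldsymbol x+\boldsymbol\beta_{\rm z}^\top\boldsymbol z))\bigr).$$ Let $\gamma_j>0$ for $j\in[n]$, $\delta_\ell>0$ for $\ell\in[m]$, and $\varepsilon\ge 0$. Let $$d(\boldsymbol\xi,\boldsymbol\xi')=\sum_{j\in[n]}\gamma_j|x_j-x_j'|+\sum_{\ell\in[m]}\delta_\ell\mathbf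 1\{\boldsymbol z_\ell\ne\boldsymbol z'_\ell\}+\kappa\,\mathbf 1\{y\ne y'\}$$ with $\kappa=\infty$ (and $\infty\cdot 0=0$), let $W$ be the Wasserstein distance with transport cost $d$ (the infimum of $\int d\,\mathrm d\Pi$ over all couplings $\Pi$), let $\widehat{\mathbb P}_N=\frac1N\sum_{i}\mathrm{Dirac}(\boldsymbol\xi^i)$ be the empirical distribution, and let $\mathfrak B_\varepsilon(\widehat{\mathbb P}_N)$ be the set of probability distributions $\mathbb Q$ on $\Xi$ with $W(\mathbb Q,\widehat{\mathbb P}_N)\le\varepsilon$. Then the distributionally robust logistic regression problem $$\inf_{\boldsymbol\beta\in\mathbb R^{1+n+c}}\ \sup_{\mathbb Q\in\mathfrak B_\varepsilon(\widehat{\mathbb P}_N)}\mathbb E_{\mathbb Q}[l_{\boldsymbol\beta}(\boldsymbol x,\boldsymbol z,y)]\qquad(1)$$ can be reformulated as $$\begin{array}{rl}\displaystyle\inf_{\lambda,\boldsymbol r,\boldsymbol\beta}&\lambda\varepsilon+\frac1N\sum_{i\in[N]}r_i\\[1mm]\text{s.t.}& l_{\boldsymbol\beta}(\boldsymbol x^i,\boldsymbol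 z,y^i)-\lambda\sum_{\ell\in[m]}\delta_\ell\mathbf 1\{\boldsymbol z_\ell\ne\boldsymbol z^i_\ell\}\le r_i\quad\forall i\in[N],\ \boldsymbol z\in\mathcal C,\\[1mm]&|\gamma_j^{-1}\beta_{{\rm x}j}|\le\lambda\quad\forall j\in[n],\\[1mm]&\lambda\ge 0,\ \boldsymbol r\in\mathbb R^N,\ \boldsymbol\beta\in\mathbb R^{1+n+c}.\end{array}\qquad(2)$$ That is: for every $\boldsymbol\beta$, the supremum in (1) is finite and equals the minimum of the objective of (2) over the $(\lambda,\boldsymbol r)$ that are feasible together with $\boldsymbol\beta$, and this minimum is attained; (1) and (2) have the same optimal value; and $\boldsymbol\beta$ is optimal in (1) if and only if $(\lambda,\boldsymbol r,\boldsymbol\beta)$ is optimal in (2) for some $\lambda,\boldsymbol r$. Problem (2) is a convex program with finitely many constraints: the objective and all constraint functions are convex in $(\lambda,\boldsymbol r,\boldsymbol\beta)$, and the feasible set is convex. Its log-loss constraints can be written as exponential-cone constraints: with $$\mathcal K_{\exp}=\mathrm{cl}\{(a,b,t)\in\mathbb R^3:a\ge b\exp(t/b),\ a>0,\ b>0\},$$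 the log-loss constraint for $(i,\boldsymbol z)$ holds if and only if there are $u,v\in\mathbb R$ with $$u+v\le 1,\qquad (u,1,-s)\in\mathcal K_{\exp},\qquad \bigl(v,1,-y^i(\beta_0+\boldsymbol\beta_{\rm x}^\top\boldsymbol x^i+\boldsymbol\beta_{\rm z}^\top\boldsymbol z)-s\bigr)\in\mathcal K_{\exp},$$ where $s=\lambda\sum_\ell\delta_\ell\mathbf 1\{\boldsymbol z_\ell\ne\boldsymbol z^i_\ell\}+r_i$. The exponential-cone program obtained from (2) by replacing all log-loss constraints in this way, with auxiliary variables $u_{i\boldsymbol z},v_{i\boldsymbol z}$, has a convex feasible set whose projection to $(\lambda,\boldsymbol r,\boldsymbol\beta)$ is the feasible set of (2), and it has the same optimal value. -/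

import Mathlib

open MeasureTheory
open scoped ENNReal

noncomputable section

/-- One-hot encodings of a categorical feature with `k + 1` possible values:
binary vectors of length `k` whose entries sum to at most one. -/
abbrev OneHot (k : ℕ) : Type :=
  {z : Fin k → ℝ // (∀ t, z t = 0 ∨ z t = 1) ∧ ∑ t, z t ≤ 1}

/-- The support of the categorical features. Feature `ℓ` has `k ℓ + 1` possible values, hence
`k ℓ` encoded coordinates. -/
abbrev CatSpace {m : ℕ} (k : Fin m → ℕ) : Type := (ℓ : Fin m) → OneHot (k ℓ)

/-- Binary labels `-1`, `+1`. -/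
abbrev BinLabel : Type := {y : ℝ // y = -1 ∨ y = 1}

/-- Data points `(x, z, y)`, with the product (Borel) measurable structure. -/
abbrev Datum (n : ℕ) {m : ℕ} (k : Fin m → ℕ) : Type :=
  (Fin n → ℝ) × CatSpace k × BinLabel

/-- Coefficients `β = (β₀, βx, βz)`. -/
abbrev Coef (n : ℕ) {m : ℕ} (k : Fin m → ℕ) : Type :=
  ℝ × (Fin n → ℝ) × ((ℓ : Fin m) → Fin (k ℓ) → ℝ)

/-- The affine score `β₀ + βxᵀ x + βzᵀ z`. -/
def score {n m : ℕ} {k : Fin m → ℕ} (β : Coef n k) (x : Fin n → ℝ) (z : CatSpace k) : ℝ :=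
  β.1 + ∑ j, β.2.1 j * x j + ∑ ℓ, ∑ t, β.2.2 ℓ t * (z ℓ).1 t

/-- The log-loss `log (1 + exp (-y (β₀ + βxᵀ x + βzᵀ z)))`. -/
def logLoss {n m : ℕ} {k : Fin m → ℕ} (β : Coef n k) (x : Fin n → ℝ) (z : CatSpace k)
    (y : BinLabel) : ℝ :=
  Real.log (1 + Real.exp (-y.1 * score β x z))

open Classical in
/-- Weighted mismatch of categorical features, `∑ ℓ, δ ℓ * 1{z ℓ ≠ z' ℓ}`. -/
def catDist {m : ℕ} {k : Fin m → ℕ} (δ : Fin m → ℝ) (z z' : CatSpace k) : ℝ :=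
  ∑ ℓ, δ ℓ * (if z ℓ ≠ z' ℓ then 1 else 0)

open Classical in
/-- The weighted distance on data points; the label-shift cost `κ` may be infinite. -/
def weightedDist {n m : ℕ} {k : Fin m → ℕ} (γ : Fin n → ℝ) (δ : Fin m → ℝ) (κ : ℝ≥0∞)
    (ξ ξ' : Datum n k) : ℝ≥0∞ :=
  ENNReal.ofReal (∑ j, γ j * |ξ.1 j - ξ'.1 j|) + ENNReal.ofReal (catDist δ ξ.2.1 ξ'.2.1)
    + (if ξ.2.2 ≠ ξ'.2.2 then κ else 0)

/-- The Wasserstein distance for the transport cost `d`: the infimum of the transport cost over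
all couplings. -/
def wassersteinDist {Ξ : Type*} [MeasurableSpace Ξ] (d : Ξ → Ξ → ℝ≥0∞) (Q P : Measure Ξ) :
    ℝ≥0∞ :=
  ⨅ π ∈ {π : Measure (Ξ × Ξ) | IsProbabilityMeasure π ∧
      π.map Prod.fst = Q ∧ π.map Prod.snd = P}, ∫⁻ p, d p.1 p.2 ∂π

/-- The empirical distribution `(1/N) ∑ i, dirac (ξ i)`. -/
def empiricalMeasure {Ξ : Type*} [MeasurableSpace Ξ] {N : ℕ} (ξ : Fin N → Ξ) : Measure Ξ :=
  (N : ℝ≥0∞)⁻¹ • ∑ i, Measure.dirac (ξ i)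

/-- The Wasserstein ball of radius `ε` around `P`. -/
def wassersteinBall {Ξ : Type*} [MeasurableSpace Ξ] (d : Ξ → Ξ → ℝ≥0∞) (P : Measure Ξ) (ε : ℝ) :
    Set (Measure Ξ) :=
  {Q | IsProbabilityMeasure Q ∧ wassersteinDist d Q P ≤ ENNReal.ofReal ε}

/-- The expected log-loss under `Q`, in `[0, ∞]` (the log-loss is positive). -/
def expectedLoss {n m : ℕ} {k : Fin m → ℕ} (β : Coef n k) (Q : Measure (Datum n k)) : ℝ≥0∞ :=
  ∫⁻ ξ, ENNReal.ofReal (logLoss β ξ.1 ξ.2.1 ξ.2.2) ∂Q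

/-- The worst-case expected log-loss over the Wasserstein ball around the empirical distribution:
the objective function of the distributionally robust logistic regression problem. -/
def worstCaseLoss {N n m : ℕ} {k : Fin m → ℕ} (ξ : Fin N → Datum n k) (γ : Fin n → ℝ)
    (δ : Fin m → ℝ) (κ : ℝ≥0∞) (ε : ℝ) (β : Coef n k) : ℝ≥0∞ :=
  ⨆ Q ∈ wassersteinBall (weightedDist γ δ κ) (empiricalMeasure ξ) ε, expectedLoss β Q

/-- Decision variables `(lam, r, β)` of the convex program. -/
abbrev Decision (N n : ℕ) {m : ℕ} (k : Fin m → ℕ) : Type := ℝ × (Fin N → ℝ) × Coef n k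

/-- The objective function `lam * ε + (1/N) ∑ i, r i` of the convex program. -/
def programObjective {N n m : ℕ} {k : Fin m → ℕ} (ε : ℝ) (p : Decision N n k) : ℝ :=
  p.1 * ε + (1 / (N : ℝ)) * ∑ i, p.2.1 i

/-- The feasible set of the convex program. -/
def programFeasible {N n m : ℕ} {k : Fin m → ℕ} (ξ : Fin N → Datum n k) (γ : Fin n → ℝ)
    (δ : Fin m → ℝ) : Set (Decision N n k) :=
  {p | (∀ (i : Fin N) (z : CatSpace k),
          logLoss p.2.2 (ξ i).1 z (ξ i).2.2 - p.1 * catDist δ z (ξ i).2.1 ≤ p.2.1 i) ∧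
       (∀ j, |(γ j)⁻¹ * p.2.2.2.1 j| ≤ p.1) ∧
       0 ≤ p.1}

/-- The exponential cone. -/
def expCone : Set (ℝ × ℝ × ℝ) :=
  closure {q | q.2.1 * Real.exp (q.2.2 / q.2.1) ≤ q.1 ∧ 0 < q.1 ∧ 0 < q.2.1}

/-- The exponential-cone form of the log-loss constraint of data point `i` and categorical vector
`z`, with auxiliary variables `u` and `v`. -/
def ExpConeConstraint {N n m : ℕ} {k : Fin m → ℕ} (ξ : Fin N → Datum n k) (δ : Fin m → ℝ)
    (i : Fin N) (z : CatSpace k) (p : Decision N n k) (u v : ℝ) : Prop :=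
  u + v ≤ 1 ∧
  (u, 1, -p.1 * catDist δ z (ξ i).2.1 - p.2.1 i) ∈ expCone ∧
  (v, 1, -(ξ i).2.2.1 * score p.2.2 (ξ i).1 z - p.1 * catDist δ z (ξ i).2.1 - p.2.1 i) ∈ expCone

/-- The feasible set of the exponential-cone program, in the variables `(lam, r, β)` and the
auxiliary variables `u i z`, `v i z`. -/
def conicFeasible {N n m : ℕ} {k : Fin m → ℕ} (ξ : Fin N → Datum n k) (γ : Fin n → ℝ)
    (δ : Fin m → ℝ) :
    Set (Decision N n k × (Fin N → CatSpace k → ℝ) × (Fin N → CatSpace k → ℝ)) :=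
  {q | (∀ (i : Fin N) (z : CatSpace k),
          ExpConeConstraint ξ δ i z q.1 (q.2.1 i z) (q.2.2 i z)) ∧
       (∀ j, |(γ j)⁻¹ * q.1.2.2.2.1 j| ≤ q.1.1) ∧
       0 ≤ q.1.1}

end

/-! Fix `β` and argue by Lagrangian duality for the transport budget. Infinite label cost forbids
label changes, and softplus is 1-Lipschitz, so a multiplier `lam` with `|β j| ≤ lam * γ j` pays for
every numerical displacement. Only categorical changes remain, and they are priced by `r`.
Integrating this pointwise bound against a coupling gives weak duality
(`worstCaseLoss_le_programObjective`).

For the converse, take `r` as small as possible. A sum of independent maxima is a maximum over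
selections `s : Fin N → CatSpace k`, so the dual function is the upper envelope of the finitely many
lines `meanLoss s + lam * (ε - meanCost s)`, minimised over `lam ≥ c` with `c` the largest scaled
slope. At a minimiser (`exists_active_slopes`) there are two cases. Active lines of opposite slopes
can be mixed to a distribution that spends exactly `ε` and attains the dual value. Otherwise the
minimiser is `c`, and the unspent budget is turned into loss at rate `c` by sending a vanishing
fraction of mass to infinity along one numerical coordinate (`meanLoss_add_le_worstCaseLoss`).

Convexity and the conic form both come from `log_one_add_exp_le_iff`. -/

instance finite_oneHot (k : ℕ) : Finite (OneHot k) := by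
  have hf : (Set.univ.pi fun _ : Fin k => ({0, 1} : Set ℝ)).Finite :=
    Set.Finite.pi fun _ => Set.toFinite _
  exact (hf.subset fun z hz => by
    intro t _
    simpa using hz.1 t).to_subtype

/-! ### Softplus and the exponential cone. -/

/-- Divide `1 + exp t ≤ exp s` by `exp s`. Both summands are exponentials of linear forms in `(t,
s)`, so the epigraph of softplus is visibly convex and splits into two exponential-cone constraints.
-/
lemma log_one_add_exp_le_iff (t s : ℝ) :
    Real.log (1 + Real.exp t) ≤ s ↔ Real.exp (-s) + Real.exp (t - s) ≤ 1 := by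
  rw [Real.log_le_iff_le_exp (by positivity), sub_eq_add_neg, Real.exp_add, ← one_add_mul,
    Real.exp_neg, ← div_eq_mul_inv, div_le_one (Real.exp_pos s)]

lemma log_one_add_exp_convexOn : ConvexOn ℝ Set.univ fun t : ℝ => Real.log (1 + Real.exp t) := by
  refine ⟨convex_univ, fun x _ y _ a b ha hb hab => ?_⟩
  simp only [smul_eq_mul]
  rw [log_one_add_exp_le_iff]
  -- Points on the graph lie in the epigraph; convexity of `exp` keeps their combination there.
  have hx := (log_one_add_exp_le_iff x _).1 le_rfl
  have hy := (log_one_add_exp_le_iff y _).1 le_rfl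
  set u := Real.log (1 + Real.exp x)
  set v := Real.log (1 + Real.exp y)
  have h1 := convexOn_exp.2 (Set.mem_univ (-u)) (Set.mem_univ (-v)) ha hb hab
  have h2 := convexOn_exp.2 (Set.mem_univ (x - u)) (Set.mem_univ (y - v)) ha hb hab
  simp only [smul_eq_mul] at h1 h2
  rw [show -(a * u + b * v) = a * -u + b * -v by ring,
    show a * x + b * y - (a * u + b * v) = a * (x - u) + b * (y - v) by ring]
  nlinarith

lemma log_one_add_exp_add_le (t : ℝ) {h : ℝ} (hh : 0 ≤ h) :
    Real.log (1 + Real.exp (t + h)) ≤ Real.log (1 + Real.exp t) + h := by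
  rw [Real.log_le_iff_le_exp (by positivity), Real.exp_add, Real.exp_add,
    Real.exp_log (by positivity)]
  nlinarith [Real.one_le_exp hh]

/-- The asymptotic slope 1 of softplus: it bounds from below the loss of mass sent far away. -/
lemma le_log_one_add_exp (t : ℝ) : t ≤ Real.log (1 + Real.exp t) := by
  rw [Real.le_log_iff_exp_le (by positivity)]
  linarith

/-- The defining inequality is continuous where the middle coordinate is nonzero, so the closure
adds no points on the slice where it equals 1. -/
lemma mem_expCone_iff (u t : ℝ) : (u, 1, t) ∈ expCone ↔ Real.exp t ≤ u := by
  constructor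
  · intro h
    have hc : ContinuousAt (fun q : ℝ × ℝ × ℝ => q.2.1 * Real.exp (q.2.2 / q.2.1)) (u, 1, t) := by
      have : ((u, 1, t) : ℝ × ℝ × ℝ).2.1 ≠ 0 := one_ne_zero
      fun_prop (disch := assumption)
    simpa using hc.continuousWithinAt.closure_le h continuous_fst.continuousWithinAt
      fun q hq => hq.1
  · intro h
    exact subset_closure ⟨by simpa using h, (Real.exp_pos t).trans_le h, one_pos⟩

/-! ### Convexity and conic form of the program. -/

section Program

variable {N n m : ℕ} {k : Fin m → ℕ}

lemma score_combo (a b : ℝ) (β β' : Coef n k) (x : Fin n → ℝ) (z : CatSpace k) :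
    score (a • β + b • β') x z = a * score β x z + b * score β' x z := by
  simp only [score, Prod.fst_add, Prod.snd_add, Prod.smul_fst, Prod.smul_snd, Pi.add_apply,
    Pi.smul_apply, smul_eq_mul, add_mul, mul_assoc, Finset.sum_add_distrib, mul_add,
    Finset.mul_sum]
  ring

lemma expConeConstraint_iff (ξ : Fin N → Datum n k) (δ : Fin m → ℝ) (i : Fin N) (z : CatSpace k)
    (p : Decision N n k) (u v : ℝ) :
    ExpConeConstraint ξ δ i z p u v ↔ u + v ≤ 1 ∧
      Real.exp (-p.1 * catDist δ z (ξ i).2.1 - p.2.1 i) ≤ u ∧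
      Real.exp (-(ξ i).2.2.1 * score p.2.2 (ξ i).1 z - p.1 * catDist δ z (ξ i).2.1 - p.2.1 i)
        ≤ v := by
  simp only [ExpConeConstraint, mem_expCone_iff]

lemma logLoss_constraint_iff (ξ : Fin N → Datum n k) (δ : Fin m → ℝ) (i : Fin N)
    (z : CatSpace k) (p : Decision N n k) :
    logLoss p.2.2 (ξ i).1 z (ξ i).2.2 - p.1 * catDist δ z (ξ i).2.1 ≤ p.2.1 i ↔
      ∃ u v : ℝ, ExpConeConstraint ξ δ i z p u v := by
  simp only [expConeConstraint_iff]
  rw [sub_le_iff_le_add, logLoss, log_one_add_exp_le_iff]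
  have e1 : -(p.2.1 i + p.1 * catDist δ z (ξ i).2.1)
      = -p.1 * catDist δ z (ξ i).2.1 - p.2.1 i := by ring
  have e2 : -(ξ i).2.2.1 * score p.2.2 (ξ i).1 z - (p.2.1 i + p.1 * catDist δ z (ξ i).2.1)
      = -(ξ i).2.2.1 * score p.2.2 (ξ i).1 z - p.1 * catDist δ z (ξ i).2.1 - p.2.1 i := by ring
  rw [e1, e2]
  exact ⟨fun h => ⟨_, _, h, le_rfl, le_rfl⟩, fun ⟨u, v, h, h1, h2⟩ => by linarith⟩

lemma logLoss_constraint_convexOn (x : Fin n → ℝ) (z : CatSpace k) (y : BinLabel) (D : ℝ)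
    (i : Fin N) : ConvexOn ℝ Set.univ (fun p : Decision N n k =>
      logLoss p.2.2 x z y - p.1 * D - p.2.1 i) := by
  refine ⟨convex_univ, fun p _ q _ a b ha hb hab => ?_⟩
  have h := log_one_add_exp_convexOn.2 (Set.mem_univ (-y.1 * score p.2.2 x z))
    (Set.mem_univ (-y.1 * score q.2.2 x z)) ha hb hab
  simp only [smul_eq_mul] at h
  simp only [logLoss, Prod.fst_add, Prod.snd_add, Prod.smul_fst, Prod.smul_snd, score_combo,
    Pi.add_apply, Pi.smul_apply, smul_eq_mul]
  rw [show -y.1 * (a * score p.2.2 x z + b * score q.2.2 x z)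
    = a * (-y.1 * score p.2.2 x z) + b * (-y.1 * score q.2.2 x z) by ring]
  linarith

lemma slope_constraint_convexOn (c : ℝ) (j : Fin n) :
    ConvexOn ℝ Set.univ (fun p : Decision N n k => |c * p.2.2.2.1 j| - p.1) := by
  refine ⟨convex_univ, fun p _ q _ a b ha hb hab => ?_⟩
  simp only [Prod.fst_add, Prod.snd_add, Prod.smul_fst, Prod.smul_snd,
    Pi.add_apply, Pi.smul_apply, smul_eq_mul]
  have h := abs_add_le (a * (c * p.2.2.2.1 j)) (b * (c * q.2.2.2.1 j))
  rw [abs_mul a, abs_mul b, abs_of_nonneg ha, abs_of_nonneg hb] at h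
  rw [show c * (a * p.2.2.2.1 j + b * q.2.2.2.1 j)
    = a * (c * p.2.2.2.1 j) + b * (c * q.2.2.2.1 j) by ring]
  linarith

lemma programObjective_convexOn (ε : ℝ) :
    ConvexOn ℝ Set.univ (programObjective ε : Decision N n k → ℝ) := by
  refine ⟨convex_univ, fun p _ q _ a b ha hb hab => le_of_eq ?_⟩
  simp only [programObjective, Prod.fst_add, Prod.snd_add, Prod.smul_fst, Prod.smul_snd,
    Pi.add_apply, Pi.smul_apply, smul_eq_mul, Finset.sum_add_distrib, ← Finset.mul_sum]
  ring

lemma convex_programFeasible (ξ : Fin N → Datum n k) (γ : Fin n → ℝ) (δ : Fin m → ℝ) :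
    Convex ℝ (programFeasible ξ γ δ) := by
  intro p hp q hq a b ha hb hab
  refine ⟨fun i z => ?_, fun j => ?_, ?_⟩
  · have h := (logLoss_constraint_convexOn (ξ i).1 z (ξ i).2.2 (catDist δ z (ξ i).2.1) i).2
      (Set.mem_univ p) (Set.mem_univ q) ha hb hab
    have h1 := mul_le_mul_of_nonneg_left (sub_nonpos.2 (hp.1 i z)) ha
    have h2 := mul_le_mul_of_nonneg_left (sub_nonpos.2 (hq.1 i z)) hb
    simp only [smul_eq_mul] at h
    linarith
  · have h := (slope_constraint_convexOn (N := N) (k := k) (γ j)⁻¹ j).2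
      (Set.mem_univ p) (Set.mem_univ q) ha hb hab
    have h1 := mul_le_mul_of_nonneg_left (sub_nonpos.2 (hp.2.1 j)) ha
    have h2 := mul_le_mul_of_nonneg_left (sub_nonpos.2 (hq.2.1 j)) hb
    simp only [smul_eq_mul] at h
    linarith
  · exact add_nonneg (mul_nonneg ha hp.2.2) (mul_nonneg hb hq.2.2)

lemma image_fst_conicFeasible (ξ : Fin N → Datum n k) (γ : Fin n → ℝ) (δ : Fin m → ℝ) :
    Prod.fst '' conicFeasible ξ γ δ = programFeasible ξ γ δ := by
  ext p
  constructor
  · rintro ⟨q, hq, rfl⟩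
    exact ⟨fun i z => (logLoss_constraint_iff ξ δ i z q.1).2 ⟨_, _, hq.1 i z⟩, hq.2⟩
  · intro hp
    choose u v huv using fun i z => (logLoss_constraint_iff ξ δ i z p).1 (hp.1 i z)
    exact ⟨(p, u, v), ⟨huv, hp.2⟩, rfl⟩

lemma convex_conicFeasible (ξ : Fin N → Datum n k) (γ : Fin n → ℝ) (δ : Fin m → ℝ) :
    Convex ℝ (conicFeasible ξ γ δ) := by
  intro p hp q hq a b ha hb hab
  have hpf : p.1 ∈ programFeasible ξ γ δ :=
    image_fst_conicFeasible ξ γ δ ▸ Set.mem_image_of_mem _ hp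
  have hqf : q.1 ∈ programFeasible ξ γ δ :=
    image_fst_conicFeasible ξ γ δ ▸ Set.mem_image_of_mem _ hq
  refine ⟨fun i z => ?_, (convex_programFeasible ξ γ δ hpf hqf ha hb hab).2⟩
  obtain ⟨p1, p2, p3⟩ := (expConeConstraint_iff ..).1 (hp.1 i z)
  obtain ⟨q1, q2, q3⟩ := (expConeConstraint_iff ..).1 (hq.1 i z)
  rw [expConeConstraint_iff]
  have cvx : ∀ s t u v w : ℝ, Real.exp s ≤ u → Real.exp t ≤ v → w = a * s + b * t →
      Real.exp w ≤ a * u + b * v := by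
    rintro s t u v w hs ht rfl
    have h := convexOn_exp.2 (Set.mem_univ s) (Set.mem_univ t) ha hb hab
    simp only [smul_eq_mul] at h
    have := mul_le_mul_of_nonneg_left hs ha
    have := mul_le_mul_of_nonneg_left ht hb
    linarith
  simp only [Prod.fst_add, Prod.snd_add, Prod.smul_fst, Prod.smul_snd, score_combo,
    Pi.add_apply, Pi.smul_apply, smul_eq_mul]
  refine ⟨?_, cvx _ _ _ _ _ p2 q2 (by ring), cvx _ _ _ _ _ p3 q3 (by ring)⟩
  have := mul_le_mul_of_nonneg_left p1 ha
  have := mul_le_mul_of_nonneg_left q1 hb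
  linarith

end Program

/-! ### Integrals and images of empirical measures. -/

lemma inv_mul_sum_ofReal {N : ℕ} (hN : 0 < N) (g : Fin N → ℝ) (hg : ∀ i, 0 ≤ g i) :
    (N : ℝ≥0∞)⁻¹ * ∑ i, ENNReal.ofReal (g i) = ENNReal.ofReal (1 / (N : ℝ) * ∑ i, g i) := by
  rw [ENNReal.ofReal_mul (by positivity), ENNReal.ofReal_sum_of_nonneg fun i _ => hg i, one_div,
    ENNReal.ofReal_inv_of_pos (by exact_mod_cast hN), ENNReal.ofReal_natCast]

lemma lintegral_empiricalMeasure {Ξ : Type*} [MeasurableSpace Ξ] {N : ℕ} (ξ : Fin N → Ξ)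
    {f : Ξ → ℝ≥0∞} (hf : Measurable f) :
    ∫⁻ x, f x ∂(empiricalMeasure ξ) = (N : ℝ≥0∞)⁻¹ * ∑ i, f (ξ i) := by
  simp [empiricalMeasure, lintegral_smul_measure, lintegral_dirac' _ hf]

lemma map_empiricalMeasure {Ξ Ξ' : Type*} [MeasurableSpace Ξ] [MeasurableSpace Ξ'] {N : ℕ}
    (ξ : Fin N → Ξ) {f : Ξ → Ξ'} (hf : Measurable f) :
    (empiricalMeasure ξ).map f = empiricalMeasure fun i => f (ξ i) := by
  ext s hs
  rw [Measure.map_apply hf hs]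
  simp only [empiricalMeasure, Measure.smul_apply, Measure.finsetSum_apply,
    Measure.dirac_apply' _ hs, Measure.dirac_apply' _ (hf hs)]
  rfl

lemma isProbabilityMeasure_empiricalMeasure {Ξ : Type*} [MeasurableSpace Ξ] {N : ℕ} (hN : 0 < N)
    (ξ : Fin N → Ξ) : IsProbabilityMeasure (empiricalMeasure ξ) := by
  constructor
  simp [empiricalMeasure, ENNReal.inv_mul_cancel (Nat.cast_ne_zero.2 hN.ne')
    (ENNReal.natCast_ne_top N)]

/-! ### Weak duality, and a family of distributions in the ball. -/

section Duality

variable {N n m : ℕ} {k : Fin m → ℕ}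

lemma measurable_logLoss (β : Coef n k) :
    Measurable fun ξ : Datum n k => logLoss β ξ.1 ξ.2.1 ξ.2.2 := by
  have : ∀ ℓ t, Measurable fun ξ : Datum n k => (ξ.2.1 ℓ).1 t := fun ℓ t =>
    (measurable_pi_apply t).comp (measurable_subtype_coe.comp
      ((measurable_pi_apply ℓ).comp measurable_snd.fst))
  have hy : Measurable fun ξ : Datum n k => ξ.2.2.1 :=
    measurable_subtype_coe.comp measurable_snd.snd
  unfold logLoss score
  fun_prop

lemma logLoss_nonneg (β : Coef n k) (x : Fin n → ℝ) (z : CatSpace k) (y : BinLabel) :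
    0 ≤ logLoss β x z y :=
  Real.log_nonneg (by linarith [Real.exp_pos (-y.1 * score β x z)])

lemma catDist_nonneg {δ : Fin m → ℝ} (hδ : ∀ ℓ, 0 < δ ℓ) (z z' : CatSpace k) :
    0 ≤ catDist δ z z' := by
  classical
  exact Finset.sum_nonneg fun ℓ _ => mul_nonneg (hδ ℓ).le (by split_ifs <;> norm_num)

lemma catDist_self (δ : Fin m → ℝ) (z : CatSpace k) : catDist δ z z = 0 := by
  simp [catDist]

lemma measurable_catDist (δ : Fin m → ℝ) :
    Measurable fun p : CatSpace k × CatSpace k => catDist δ p.1 p.2 :=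
  measurable_of_countable _

/-- The part of the distance due to the features. -/
noncomputable def featureDist (γ : Fin n → ℝ) (δ : Fin m → ℝ) (ξ ξ' : Datum n k) : ℝ :=
  ∑ j, γ j * |ξ.1 j - ξ'.1 j| + catDist δ ξ.2.1 ξ'.2.1

lemma numDist_nonneg {γ : Fin n → ℝ} (hγ : ∀ j, 0 < γ j) (x x' : Fin n → ℝ) :
    0 ≤ ∑ j, γ j * |x j - x' j| :=
  Finset.sum_nonneg fun j _ => mul_nonneg (hγ j).le (abs_nonneg _)

lemma weightedDist_of_label_eq {γ : Fin n → ℝ} (hγ : ∀ j, 0 < γ j) {δ : Fin m → ℝ}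
    (hδ : ∀ ℓ, 0 < δ ℓ) (κ : ℝ≥0∞) {ξ ξ' : Datum n k} (h : ξ.2.2 = ξ'.2.2) :
    weightedDist γ δ κ ξ ξ' = ENNReal.ofReal (featureDist γ δ ξ ξ') := by
  rw [featureDist, ENNReal.ofReal_add (numDist_nonneg hγ _ _) (catDist_nonneg hδ _ _)]
  simp [weightedDist, h]

lemma measurable_weightedDist (γ : Fin n → ℝ) (δ : Fin m → ℝ) (κ : ℝ≥0∞) :
    Measurable fun p : Datum n k × Datum n k => weightedDist γ δ κ p.1 p.2 := by
  unfold weightedDist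
  have h : Measurable fun p : Datum n k × Datum n k => ∑ j, γ j * |p.1.1 j - p.2.1 j| := by
    fun_prop
  refine (h.ennreal_ofReal.add ?_).add ?_
  · exact ENNReal.measurable_ofReal.comp ((measurable_catDist δ).comp
      (measurable_fst.snd.fst.prodMk measurable_snd.snd.fst))
  · exact Measurable.ite (measurableSet_eq_fun measurable_fst.snd.snd
      measurable_snd.snd.snd).compl measurable_const measurable_const

/-- The slope constraints say `|β j| ≤ lam * γ j`, so the signed score is `lam`-Lipschitz for the
weighted numerical distance; softplus preserves this. -/
lemma logLoss_le_add_numDist {γ : Fin n → ℝ} (hγ : ∀ j, 0 < γ j) (β : Coef n k) {lam : ℝ}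
    (hlam : ∀ j, |(γ j)⁻¹ * β.2.1 j| ≤ lam) (x x' : Fin n → ℝ) (z : CatSpace k) (y : BinLabel)
    (hlam0 : 0 ≤ lam) :
    logLoss β x z y ≤ logLoss β x' z y + lam * ∑ j, γ j * |x j - x' j| := by
  refine le_trans ?_ (log_one_add_exp_add_le _ (mul_nonneg hlam0 (numDist_nonneg hγ x x')))
  have hβ : ∀ j, |β.2.1 j| ≤ lam * γ j := fun j => by
    have := hlam j
    rwa [abs_mul, abs_of_pos (inv_pos.2 (hγ j)), inv_mul_le_iff₀ (hγ j), mul_comm] at this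
  have hs : -y.1 * score β x z - -y.1 * score β x' z = -y.1 * ∑ j, β.2.1 j * (x j - x' j) := by
    simp only [score, mul_sub, Finset.sum_sub_distrib]
    ring
  have hy : |-y.1| = 1 := by rcases y.2 with h | h <;> simp [h]
  have hb : -y.1 * ∑ j, β.2.1 j * (x j - x' j) ≤ lam * ∑ j, γ j * |x j - x' j| := by
    refine (le_abs_self _).trans ?_
    rw [abs_mul, hy, one_mul, Finset.mul_sum]
    refine (Finset.abs_sum_le_sum_abs _ _).trans (Finset.sum_le_sum fun j _ => ?_)
    rw [abs_mul, ← mul_assoc]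
    exact mul_le_mul_of_nonneg_right (hβ j) (abs_nonneg _)
  unfold logLoss
  gcongr
  linarith

/-- The value at a data point of the `lam`-regularised worst case over categorical features. -/
noncomputable def catEnvelope (β : Coef n k) (δ : Fin m → ℝ) (lam : ℝ) (ξ : Datum n k) : ℝ≥0∞ :=
  ⨆ z : CatSpace k, ENNReal.ofReal (logLoss β ξ.1 z ξ.2.2 - lam * catDist δ z ξ.2.1)

lemma measurable_catEnvelope (β : Coef n k) (δ : Fin m → ℝ) (lam : ℝ) :
    Measurable (catEnvelope β δ lam) := by
  refine Measurable.iSup fun z => ENNReal.measurable_ofReal.comp (Measurable.sub ?_ ?_)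
  · exact (measurable_logLoss β).comp
      (measurable_fst.prodMk (measurable_const.prodMk measurable_snd.snd))
  · exact ((measurable_catDist δ).comp (measurable_const.prodMk measurable_snd.fst)).const_mul lam

/-- Finite cost forces equal labels. The numerical move is then paid by `lam`, and the categorical
move is one candidate in the envelope. -/
lemma ofReal_logLoss_le {γ : Fin n → ℝ} (hγ : ∀ j, 0 < γ j) {δ : Fin m → ℝ}
    (hδ : ∀ ℓ, 0 < δ ℓ) (β : Coef n k) {lam : ℝ} (hlam0 : 0 ≤ lam)
    (hlam : ∀ j, |(γ j)⁻¹ * β.2.1 j| ≤ lam) {ξ ξ' : Datum n k}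
    (hd : weightedDist γ δ ⊤ ξ ξ' < ⊤) :
    ENNReal.ofReal (logLoss β ξ.1 ξ.2.1 ξ.2.2) ≤
      ENNReal.ofReal lam * weightedDist γ δ ⊤ ξ ξ' + catEnvelope β δ lam ξ' := by
  have hy : ξ.2.2 = ξ'.2.2 := by
    by_contra h
    simp [weightedDist, h] at hd
  have hF : 0 ≤ featureDist γ δ ξ ξ' :=
    add_nonneg (numDist_nonneg hγ _ _) (catDist_nonneg hδ _ _)
  have hs : ENNReal.ofReal (logLoss β ξ'.1 ξ.2.1 ξ'.2.2 - lam * catDist δ ξ.2.1 ξ'.2.1) ≤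
      catEnvelope β δ lam ξ' := le_iSup (fun z : CatSpace k =>
        ENNReal.ofReal (logLoss β ξ'.1 z ξ'.2.2 - lam * catDist δ z ξ'.2.1)) ξ.2.1
  rw [weightedDist_of_label_eq hγ hδ ⊤ hy, ← ENNReal.ofReal_mul hlam0]
  refine le_trans ?_ (add_le_add_right hs _)
  refine le_trans (ENNReal.ofReal_le_ofReal ?_) ENNReal.ofReal_add_le
  have := logLoss_le_add_numDist hγ β hlam ξ.1 ξ'.1 ξ.2.1 ξ.2.2 hlam0
  rw [hy] at this ⊢
  unfold featureDist
  linarith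

open Filter Topology in
lemma worstCaseLoss_le_programObjective (hN : 0 < N) (ξ : Fin N → Datum n k)
    {γ : Fin n → ℝ} (hγ : ∀ j, 0 < γ j) {δ : Fin m → ℝ} (hδ : ∀ ℓ, 0 < δ ℓ) {ε : ℝ} (hε : 0 ≤ ε)
    {lam : ℝ} {r : Fin N → ℝ} {β : Coef n k} (hp : (lam, r, β) ∈ programFeasible ξ γ δ) :
    worstCaseLoss ξ γ δ ⊤ ε β ≤ ENNReal.ofReal (programObjective ε (lam, r, β)) := by
  obtain ⟨hr, hlam, hlam0⟩ := hp
  simp only at hr hlam hlam0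
  -- The constraint at the observed categorical vector carries no mismatch penalty.
  have hr0 : ∀ i, 0 ≤ r i := fun i =>
    (logLoss_nonneg β _ _ _).trans (by simpa [catDist_self] using hr i (ξ i).2.1)
  refine iSup₂_le fun Q hQ => ?_
  -- An optimal coupling is not needed: a coupling of cost below `c` exists for each `c > ε`, and
  -- `c` tends to `ε` at the end.
  have hbound : ∀ c, ε < c → expectedLoss β Q ≤
      ENNReal.ofReal (lam * c + 1 / (N : ℝ) * ∑ i, r i) := by
    intro c hc
    have hc0 : 0 < c := hε.trans_lt hc
    obtain ⟨π, hπ⟩ := iInf_lt_iff.1 (hQ.2.trans_lt ((ENNReal.ofReal_lt_ofReal_iff hc0).2 hc))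
    obtain ⟨⟨-, hπ1, hπ2⟩, hcost⟩ := iInf_lt_iff.1 hπ
    have hfin : ∀ᵐ p ∂π, weightedDist γ δ ⊤ p.1 p.2 < ⊤ :=
      ae_lt_top (measurable_weightedDist γ δ ⊤) (hcost.trans ENNReal.ofReal_lt_top).ne
    calc expectedLoss β Q
        = ∫⁻ p, ENNReal.ofReal (logLoss β p.1.1 p.1.2.1 p.1.2.2) ∂π := by
          rw [expectedLoss, ← hπ1, lintegral_map (measurable_logLoss β).ennreal_ofReal
            measurable_fst]
      _ ≤ ∫⁻ p, (ENNReal.ofReal lam * weightedDist γ δ ⊤ p.1 p.2 + catEnvelope β δ lam p.2) ∂π :=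
          lintegral_mono_ae (hfin.mono fun p hp => ofReal_logLoss_le hγ hδ β hlam0 hlam hp)
      _ = ENNReal.ofReal lam * ∫⁻ p, weightedDist γ δ ⊤ p.1 p.2 ∂π +
            (N : ℝ≥0∞)⁻¹ * ∑ i, catEnvelope β δ lam (ξ i) := by
          have hΦ : Measurable fun p : Datum n k × Datum n k => catEnvelope β δ lam p.2 :=
            (measurable_catEnvelope β δ lam).comp measurable_snd
          rw [lintegral_add_right _ hΦ,
            lintegral_const_mul _ (measurable_weightedDist γ δ ⊤),
            ← lintegral_empiricalMeasure ξ (measurable_catEnvelope β δ lam), ← hπ2,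
            lintegral_map (measurable_catEnvelope β δ lam) measurable_snd]
      _ ≤ ENNReal.ofReal lam * ENNReal.ofReal c +
            (N : ℝ≥0∞)⁻¹ * ∑ i, ENNReal.ofReal (r i) := by
          gcongr with i
          exact iSup_le fun z => ENNReal.ofReal_le_ofReal (hr i z)
      _ = _ := by
          rw [inv_mul_sum_ofReal hN r hr0, ← ENNReal.ofReal_mul hlam0, ENNReal.ofReal_add
            (by positivity) (mul_nonneg (by positivity) (Finset.sum_nonneg fun i _ => hr0 i))]
  have hcont : Continuous fun c => ENNReal.ofReal (lam * c + 1 / (N : ℝ) * ∑ i, r i) :=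
    ENNReal.continuous_ofReal.comp (by fun_prop)
  exact ge_of_tendsto ((hcont.tendsto ε).mono_left nhdsWithin_le_nhds)
    (Filter.eventually_of_mem (self_mem_nhdsWithin : Set.Ioi ε ∈ 𝓝[>] ε) hbound)

/-- Mixtures of two empirical measures, with the labels of the data, belong to the Wasserstein
ball if the mean transport cost is at most the radius. -/
lemma mixture_le_worstCaseLoss (hN : 0 < N) (ξ : Fin N → Datum n k)
    {γ : Fin n → ℝ} (hγ : ∀ j, 0 < γ j) {δ : Fin m → ℝ} (hδ : ∀ ℓ, 0 < δ ℓ) {ε : ℝ}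
    (β : Coef n k) (S T : Fin N → Datum n k) (hS : ∀ i, (S i).2.2 = (ξ i).2.2)
    (hT : ∀ i, (T i).2.2 = (ξ i).2.2) {θ : ℝ} (h0 : 0 ≤ θ) (h1 : θ ≤ 1)
    (hcost : (1 - θ) * (1 / (N : ℝ) * ∑ i, featureDist γ δ (S i) (ξ i)) +
      θ * (1 / (N : ℝ) * ∑ i, featureDist γ δ (T i) (ξ i)) ≤ ε) :
    ENNReal.ofReal ((1 - θ) * (1 / (N : ℝ) * ∑ i, logLoss β (S i).1 (S i).2.1 (S i).2.2) +
      θ * (1 / (N : ℝ) * ∑ i, logLoss β (T i).1 (T i).2.1 (T i).2.2)) ≤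
      worstCaseLoss ξ γ δ ⊤ ε β := by
  have h1' : 0 ≤ 1 - θ := by linarith
  have hsum : ENNReal.ofReal (1 - θ) + ENNReal.ofReal θ = 1 := by
    rw [← ENNReal.ofReal_add h1' h0]
    simp
  have hF : ∀ η η' : Datum n k, 0 ≤ featureDist γ δ η η' := fun _ _ =>
    add_nonneg (numDist_nonneg hγ _ _) (catDist_nonneg hδ _ _)
  have hmean : ∀ g : Fin N → ℝ, (∀ i, 0 ≤ g i) → 0 ≤ 1 / (N : ℝ) * ∑ i, g i := fun g hg =>
    mul_nonneg (by positivity) (Finset.sum_nonneg fun i _ => hg i)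
  have hl : ∀ U : Fin N → Datum n k, ∀ i, 0 ≤ logLoss β (U i).1 (U i).2.1 (U i).2.2 := fun _ _ =>
    logLoss_nonneg ..
  -- Stated for a general space because it serves both the mixture and its coupling with the data.
  have hprob : ∀ {Ξ : Type} [MeasurableSpace Ξ] (U V : Fin N → Ξ), IsProbabilityMeasure
      (ENNReal.ofReal (1 - θ) • empiricalMeasure U + ENNReal.ofReal θ • empiricalMeasure V) := by
    intro Ξ _ U V
    have := isProbabilityMeasure_empiricalMeasure hN U
    have := isProbabilityMeasure_empiricalMeasure hN V
    constructor
    simpa using hsum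
  refine le_trans (le_of_eq ?_) (le_iSup₂ (ENNReal.ofReal (1 - θ) • empiricalMeasure S +
    ENNReal.ofReal θ • empiricalMeasure T) ⟨hprob S T, ?_⟩)
  · rw [expectedLoss, lintegral_add_measure, lintegral_smul_measure, lintegral_smul_measure,
      lintegral_empiricalMeasure _ (measurable_logLoss β).ennreal_ofReal,
      lintegral_empiricalMeasure _ (measurable_logLoss β).ennreal_ofReal,
      inv_mul_sum_ofReal hN _ (hl S), inv_mul_sum_ofReal hN _ (hl T), smul_eq_mul, smul_eq_mul,
      ← ENNReal.ofReal_mul h1', ← ENNReal.ofReal_mul h0, ENNReal.ofReal_add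
        (mul_nonneg h1' (hmean _ (hl S))) (mul_nonneg h0 (hmean _ (hl T)))]
  -- The coupling moves mass from each `ξ i` to `S i` and `T i` in proportions `1 - θ` and `θ`.
  · refine (iInf₂_le (ENNReal.ofReal (1 - θ) • empiricalMeasure (fun i => (S i, ξ i)) +
      ENNReal.ofReal θ • empiricalMeasure (fun i => (T i, ξ i))) ⟨hprob _ _, ?_, ?_⟩).trans ?_
    · have hd := measurable_weightedDist (k := k) γ δ ⊤
      rw [lintegral_add_measure, lintegral_smul_measure, lintegral_smul_measure,
        lintegral_empiricalMeasure _ hd, lintegral_empiricalMeasure _ hd]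
      simp only [fun i => weightedDist_of_label_eq hγ hδ ⊤ (hS i),
        fun i => weightedDist_of_label_eq hγ hδ ⊤ (hT i)]
      rw [inv_mul_sum_ofReal hN _ (fun i => hF _ _), inv_mul_sum_ofReal hN _ (fun i => hF _ _),
        smul_eq_mul, smul_eq_mul,
        ← ENNReal.ofReal_mul h1', ← ENNReal.ofReal_mul h0, ← ENNReal.ofReal_add
        (mul_nonneg h1' (hmean _ fun i => hF _ _)) (mul_nonneg h0 (hmean _ fun i => hF _ _))]
      exact ENNReal.ofReal_le_ofReal hcost
    · rw [Measure.map_add _ _ measurable_fst, Measure.map_smul, Measure.map_smul,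
        map_empiricalMeasure _ measurable_fst, map_empiricalMeasure _ measurable_fst]
    · rw [Measure.map_add _ _ measurable_snd, Measure.map_smul, Measure.map_smul,
        map_empiricalMeasure _ measurable_snd, map_empiricalMeasure _ measurable_snd,
        ← add_smul, hsum, one_smul]

end Duality

/-! ### Minimising a finite envelope of lines. -/

open Filter Topology in
/-- The upper envelope of finitely many lines, one of them nondecreasing, has a minimiser on
`[c, ∞)`, described by the slopes of the lines active there. -/
lemma exists_active_slopes {S : Type*} [Finite S] (a b : S → ℝ) (c : ℝ) {s₀ : S}
    (hs₀ : 0 ≤ b s₀) :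
    ∃ t M : ℝ, c ≤ t ∧ (∀ s, a s + t * b s ≤ M) ∧ (∃ s, a s + t * b s = M ∧ 0 ≤ b s) ∧
      (t = c ∨ ∃ s, a s + t * b s = M ∧ b s ≤ 0) := by
  have := Fintype.ofFinite S
  have hne : (Finset.univ : Finset S).Nonempty := ⟨s₀, Finset.mem_univ _⟩
  set h : ℝ → ℝ := fun t => Finset.univ.sup' hne fun s => a s + t * b s with hh
  have hle : ∀ s t, a s + t * b s ≤ h t := fun s t =>
    Finset.le_sup' (fun s => a s + t * b s) (Finset.mem_univ s)
  have hatt : ∀ t, ∃ s, a s + t * b s = h t := fun t => by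
    obtain ⟨s, -, hs⟩ := Finset.exists_mem_eq_sup' hne fun s => a s + t * b s
    exact ⟨s, hs.symm⟩
  have hcont : Continuous h := Continuous.finset_sup'_apply hne fun s _ => by fun_prop
  -- At `L` the line of `s₀` has caught up with every decreasing line, so the envelope never drops
  -- below `h L` beyond `L`, and minimising over the compact `[c, L]` suffices.
  obtain ⟨L, hcL, hL⟩ : ∃ L, c ≤ L ∧ ∀ s, b s < 0 → a s + L * b s ≤ a s₀ + L * b s₀ := by
    have : ∀ᶠ L : ℝ in atTop, ∀ s, b s < 0 → a s + L * b s ≤ a s₀ + L * b s₀ := by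
      refine eventually_all.2 fun s => ?_
      by_cases hs : b s < 0
      · filter_upwards [eventually_ge_atTop ((a s - a s₀) / (b s₀ - b s))] with L hL _
        rw [div_le_iff₀ (by linarith)] at hL
        linarith
      · exact Eventually.of_forall fun _ h => absurd h hs
    exact ((eventually_ge_atTop c).and this).exists
  obtain ⟨t, ⟨hct, htL⟩, htmin⟩ :=
    isCompact_Icc.exists_isMinOn ⟨c, Set.left_mem_Icc.2 hcL⟩ hcont.continuousOn
  have hmin : ∀ u, c ≤ u → h t ≤ h u := by
    intro u hu
    rcases le_total u L with huL | hLu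
    · exact htmin ⟨hu, huL⟩
    · refine (htmin ⟨hcL, le_rfl⟩ : h t ≤ h L).trans ?_
      obtain ⟨s, hs⟩ := hatt L
      rcases lt_or_ge (b s) 0 with hb | hb
      · nlinarith [hL s hb, hle s₀ u]
      · nlinarith [hle s u]
  refine ⟨t, h t, hct, fun s => hle s t, ?_, ?_⟩
  -- If every active line decreased, a small step to the right would lower the envelope: active
  -- lines fall, and inactive ones stay below by continuity.
  · by_contra! hcon
    have hev : ∀ᶠ u in 𝓝[>] t, ∀ s, a s + u * b s < h t := by
      refine eventually_all.2 fun s => ?_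
      rcases (hle s t).eq_or_lt with he | hlt
      · filter_upwards [self_mem_nhdsWithin] with u hu
        have hu : t < u := hu
        nlinarith [hcon s he]
      · have : ContinuousAt (fun u => a s + u * b s) t := by fun_prop
        exact (this.eventually_lt continuousAt_const hlt).filter_mono nhdsWithin_le_nhds
    obtain ⟨u, hu, htu⟩ := (hev.and self_mem_nhdsWithin).exists
    obtain ⟨s, hs⟩ := hatt u
    have htu : t < u := htu
    exact absurd (hmin u (hct.trans htu.le)) (by rw [← hs]; exact not_le.2 (hu s))
  -- The mirror argument, with a step to the left that `c < t` leaves room for.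
  · by_contra! hcon
    obtain ⟨hne', hcon⟩ := hcon
    have hlt' : c < t := lt_of_le_of_ne hct (Ne.symm hne')
    have hev : ∀ᶠ u in 𝓝[<] t, ∀ s, a s + u * b s < h t := by
      refine eventually_all.2 fun s => ?_
      rcases (hle s t).eq_or_lt with he | hlt
      · filter_upwards [self_mem_nhdsWithin] with u hu
        have hu : u < t := hu
        nlinarith [hcon s he]
      · have : ContinuousAt (fun u => a s + u * b s) t := by fun_prop
        exact (this.eventually_lt continuousAt_const hlt).filter_mono nhdsWithin_le_nhds
    obtain ⟨u, hu, hcu⟩ := (hev.and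
      ((eventually_gt_nhds hlt').filter_mono nhdsWithin_le_nhds)).exists
    obtain ⟨s, hs⟩ := hatt u
    exact absurd (hmin u hcu.le) (by rw [← hs]; exact not_le.2 (hu s))

/-! ### Strong duality. -/

section StrongDuality

variable {N n m : ℕ} {k : Fin m → ℕ}

lemma programObjective_nonneg (ξ : Fin N → Datum n k) (γ : Fin n → ℝ) (δ : Fin m → ℝ) {ε : ℝ}
    (hε : 0 ≤ ε) {p : Decision N n k} (hp : p ∈ programFeasible ξ γ δ) :
    0 ≤ programObjective ε p := by
  have hr0 : ∀ i, 0 ≤ p.2.1 i := fun i =>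
    (logLoss_nonneg p.2.2 _ _ _).trans (by simpa [catDist_self] using hp.1 i (ξ i).2.1)
  exact add_nonneg (mul_nonneg hp.2.2 hε)
    (mul_nonneg (by positivity) (Finset.sum_nonneg fun i _ => hr0 i))

lemma score_update (β : Coef n k) (x : Fin n → ℝ) (z : CatSpace k) (j : Fin n) (h : ℝ) :
    score β (Function.update x j (x j + h)) z = score β x z + β.2.1 j * h := by
  have : ∑ i, β.2.1 i * Function.update x j (x j + h) i
      = ∑ i, β.2.1 i * x i + β.2.1 j * h := by
    rw [← sub_eq_iff_eq_add', ← Finset.sum_sub_distrib, Finset.sum_eq_single j]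
    · simp [mul_add]
    · intro i _ hi
      simp [hi]
    · simp
  rw [score, score, this]
  ring

lemma featureDist_update (γ : Fin n → ℝ) (δ : Fin m → ℝ) (x : Fin n → ℝ) (z z' : CatSpace k)
    (y y' : BinLabel) (j : Fin n) (h : ℝ) :
    featureDist γ δ (Function.update x j (x j + h), z, y) (x, z', y') =
      γ j * |h| + catDist δ z z' := by
  rw [featureDist, Finset.sum_eq_single j]
  · simp
  · intro i _ hi
    simp [hi]
  · simp

lemma featureDist_same (γ : Fin n → ℝ) (δ : Fin m → ℝ) (x : Fin n → ℝ) (z z' : CatSpace k)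
    (y y' : BinLabel) : featureDist γ δ (x, z, y) (x, z', y') = catDist δ z z' := by
  simp [featureDist]

/-- `c` is the left end of the admissible multipliers. The last alternative is what a minimiser at
`c` needs: unspent budget is either worth nothing or can be spent at rate `c` along coordinate `j`.
-/
lemma exists_least_slope_bound (γ : Fin n → ℝ) (β : Coef n k) :
    ∃ c : ℝ, 0 ≤ c ∧ (∀ j, |(γ j)⁻¹ * β.2.1 j| ≤ c) ∧
      (c = 0 ∨ ∃ j, |(γ j)⁻¹ * β.2.1 j| = c) := by
  rcases isEmpty_or_nonempty (Fin n) with hn | hn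
  · exact ⟨0, le_rfl, fun j => isEmptyElim j, Or.inl rfl⟩
  · obtain ⟨j, hj⟩ := Finite.exists_max fun j => |(γ j)⁻¹ * β.2.1 j|
    exact ⟨_, abs_nonneg _, hj, Or.inr ⟨j, rfl⟩⟩

/-- Mean log-loss after replacing the categorical features of the data by `s`. -/
noncomputable def meanLoss (ξ : Fin N → Datum n k) (β : Coef n k) (s : Fin N → CatSpace k) : ℝ :=
  1 / (N : ℝ) * ∑ i, logLoss β (ξ i).1 (s i) (ξ i).2.2

/-- Mean cost of replacing the categorical features of the data by `s`. -/
noncomputable def meanCost (ξ : Fin N → Datum n k) (δ : Fin m → ℝ) (s : Fin N → CatSpace k) : ℝ :=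
  1 / (N : ℝ) * ∑ i, catDist δ (s i) (ξ i).2.1

variable (hN : 0 < N) (ξ : Fin N → Datum n k) {γ : Fin n → ℝ} (hγ : ∀ j, 0 < γ j)
  {δ : Fin m → ℝ} (hδ : ∀ ℓ, 0 < δ ℓ) {ε : ℝ} (β : Coef n k)

include hN hγ hδ

lemma mix_meanLoss_le_worstCaseLoss (s s' : Fin N → CatSpace k) {θ : ℝ} (h0 : 0 ≤ θ)
    (h1 : θ ≤ 1) (h : (1 - θ) * meanCost ξ δ s + θ * meanCost ξ δ s' ≤ ε) :
    ENNReal.ofReal ((1 - θ) * meanLoss ξ β s + θ * meanLoss ξ β s') ≤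
      worstCaseLoss ξ γ δ ⊤ ε β :=
  mixture_le_worstCaseLoss hN ξ hγ hδ β (fun i => ((ξ i).1, s i, (ξ i).2.2))
    (fun i => ((ξ i).1, s' i, (ξ i).2.2)) (fun _ => rfl) (fun _ => rfl) h0 h1
    (by
      have := fun (s : Fin N → CatSpace k) i => featureDist_same γ δ (ξ i).1 (s i) (ξ i).2.1
        (ξ i).2.2 (ξ i).2.2
      simp only [Prod.mk.eta] at this
      simpa only [this, meanCost] using h)

open Filter Topology in
/-- Moving a vanishing fraction of the mass far along a numerical feature uses up the remaining
transport budget at the rate given by the coefficient of that feature. -/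
lemma meanLoss_add_le_worstCaseLoss (s : Fin N → CatSpace k) (j : Fin n)
    (h : meanCost ξ δ s ≤ ε) :
    ENNReal.ofReal (meanLoss ξ β s + |(γ j)⁻¹ * β.2.1 j| * (ε - meanCost ξ δ s)) ≤
      worstCaseLoss ξ γ δ ⊤ ε β := by
  set ρ := ε - meanCost ξ δ s with hρ
  have hρ0 : 0 ≤ ρ := sub_nonneg.2 h
  set c := |(γ j)⁻¹ * β.2.1 j| with hc
  -- The mean linear lower bound for the loss before displacement; its weight `η` will vanish.
  set C : ℝ := 1 / (N : ℝ) * ∑ i, -(ξ i).2.2.1 * score β (ξ i).1 (s i) with hC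
  have hNne : (N : ℝ) ≠ 0 := by positivity
  obtain ⟨σ, hσ1, hσ⟩ : ∃ σ : ℝ, |σ| = 1 ∧ β.2.1 j * σ = |β.2.1 j| := by
    rcases le_total 0 (β.2.1 j) with hb | hb
    · exact ⟨1, by simp, by simp [abs_of_nonneg hb]⟩
    · exact ⟨-1, by simp, by simp [abs_of_nonpos hb]⟩
  have hmix : ∀ η ∈ Set.Ioc (0 : ℝ) 1, ENNReal.ofReal ((1 - η) * meanLoss ξ β s + η * C + c * ρ) ≤
      worstCaseLoss ξ γ δ ⊤ ε β := by
    rintro η ⟨hη0, hη1⟩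
    -- Chosen so that moving a fraction `η` by `τ` costs `η * γ j * τ = ρ`, exactly the unspent
    -- budget. The direction `-y * σ` increases the loss.
    set τ := ρ / (η * γ j) with hτ
    have hτ0 : 0 ≤ τ := div_nonneg hρ0 (mul_nonneg hη0.le (hγ j).le)
    set sh : Fin N → ℝ := fun i => -(ξ i).2.2.1 * σ * τ with hsh
    have hy : ∀ i, |(ξ i).2.2.1| = 1 ∧ (ξ i).2.2.1 * (ξ i).2.2.1 = 1 := fun i => by
      rcases (ξ i).2.2.2 with h | h <;> simp [h]
    have hshabs : ∀ i, |sh i| = τ := fun i => by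
      simp [hsh, abs_mul, hy, hσ1, abs_of_nonneg hτ0]
    refine le_trans (ENNReal.ofReal_le_ofReal ?_) (mixture_le_worstCaseLoss hN ξ hγ hδ β
      (fun i => ((ξ i).1, s i, (ξ i).2.2))
      (fun i => (Function.update (ξ i).1 j ((ξ i).1 j + sh i), s i, (ξ i).2.2))
      (fun _ => rfl) (fun _ => rfl) hη0.le hη1 ?_)
    · have hcρ : c * ρ = η * (|β.2.1 j| * τ) := by
        have := (hγ j).ne'
        rw [hc, hτ, abs_mul, abs_of_pos (inv_pos.2 (hγ j))]
        field_simp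
      have hsum : C + |β.2.1 j| * τ ≤ 1 / (N : ℝ) * ∑ i,
          logLoss β (Function.update (ξ i).1 j ((ξ i).1 j + sh i)) (s i) (ξ i).2.2 := by
        have : C + |β.2.1 j| * τ = 1 / (N : ℝ) * ∑ i,
            (-(ξ i).2.2.1 * score β (ξ i).1 (s i) + |β.2.1 j| * τ) := by
          rw [Finset.sum_add_distrib, mul_add, ← hC]
          simp
          field_simp
        rw [this]
        gcongr with i
        refine le_trans (le_of_eq ?_) (le_log_one_add_exp _)
        rw [score_update, ← hσ]
        linear_combination (-(β.2.1 j * σ * τ)) * (hy i).2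
      have := mul_le_mul_of_nonneg_left hsum hη0.le
      simp only [meanLoss]
      linarith
    · have e1 := fun i => featureDist_same γ δ (ξ i).1 (s i) (ξ i).2.1 (ξ i).2.2 (ξ i).2.2
      have e2 := fun i => featureDist_update γ δ (ξ i).1 (s i) (ξ i).2.1 (ξ i).2.2 (ξ i).2.2 j
        (sh i)
      simp only [Prod.mk.eta, hshabs] at e1 e2
      simp only [e1, e2, Finset.sum_add_distrib, Finset.sum_const, Finset.card_univ,
        Fintype.card_fin, nsmul_eq_mul]
      have hρτ : η * (1 / (N : ℝ) * (N * (γ j * τ))) = ρ := by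
        have := (hγ j).ne'
        rw [hτ]
        field_simp
      have hm : meanCost ξ δ s = 1 / (N : ℝ) * ∑ i, catDist δ (s i) (ξ i).2.1 := rfl
      rw [mul_add, mul_add, hρτ, ← hm]
      linarith
  have hcont : Continuous fun η => ENNReal.ofReal ((1 - η) * meanLoss ξ β s + η * C + c * ρ) :=
    ENNReal.continuous_ofReal.comp (by fun_prop)
  -- As `η` tends to 0 the gain `c * ρ`, which does not depend on `η`, survives.
  have := le_of_tendsto ((hcont.tendsto 0).mono_left (nhdsWithin_le_nhds (s := Set.Ioi 0)))
    (Filter.eventually_of_mem (Ioc_mem_nhdsGT one_pos) hmix)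
  simpa using this

lemma exists_optimal_multiplier (hε : 0 ≤ ε) :
    ∃ (lam : ℝ) (r : Fin N → ℝ), (lam, r, β) ∈ programFeasible ξ γ δ ∧
      ENNReal.ofReal (programObjective ε (lam, r, β)) ≤ worstCaseLoss ξ γ δ ⊤ ε β := by
  obtain ⟨c, hc0, hc, hcase⟩ := exists_least_slope_bound γ β
  -- Leaving the data unchanged costs nothing, which supplies the nondecreasing line.
  have hs₀ : 0 ≤ ε - meanCost ξ δ fun i => (ξ i).2.1 := by
    simpa [meanCost, catDist_self] using hε
  obtain ⟨t, M, hct, hM, ⟨s, hsM, hsb⟩, ht⟩ := exists_active_slopes (meanLoss ξ β)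
    (fun s => ε - meanCost ξ δ s) c hs₀
  have hmax : ∀ i, ∃ z : CatSpace k, ∀ z',
      logLoss β (ξ i).1 z' (ξ i).2.2 - t * catDist δ z' (ξ i).2.1 ≤
        logLoss β (ξ i).1 z (ξ i).2.2 - t * catDist δ z (ξ i).2.1 := fun i =>
    have : Nonempty (CatSpace k) := ⟨(ξ i).2.1⟩
    Finite.exists_max _
  choose z hz using hmax
  refine ⟨t, fun i => logLoss β (ξ i).1 (z i) (ξ i).2.2 - t * catDist δ (z i) (ξ i).2.1,
    ⟨hz, fun j => (hc j).trans hct, hc0.trans hct⟩, ?_⟩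
  -- With the tight `r`, the objective is the value at `t` of the line of the selection `z`.
  have hobj : programObjective ε ((t, fun i => logLoss β (ξ i).1 (z i) (ξ i).2.2 -
      t * catDist δ (z i) (ξ i).2.1, β) : Decision N n k) ≤ M := by
    refine le_trans (le_of_eq ?_) (hM z)
    simp only [programObjective, meanLoss, meanCost, Finset.sum_sub_distrib, ← Finset.mul_sum]
    ring
  refine (ENNReal.ofReal_le_ofReal hobj).trans ?_
  rcases ht with rfl | ⟨s', hsM', hsb'⟩
  · rcases hcase with rfl | ⟨j, rfl⟩
    · have := mix_meanLoss_le_worstCaseLoss (ε := ε) hN ξ hγ hδ β s s le_rfl zero_le_one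
        (by linarith)
      rw [← hsM]
      simpa using this
    · rw [← hsM]
      exact meanLoss_add_le_worstCaseLoss hN ξ hγ hδ β s j (sub_nonneg.1 hsb)
  -- Weights that make the mixed slope zero: the mixture spends exactly `ε`, and its loss is the
  -- common value `M` of the two lines at `t`.
  · obtain ⟨θ, hθ0, hθ1, hθ⟩ : ∃ θ : ℝ, 0 ≤ θ ∧ θ ≤ 1 ∧
        (1 - θ) * (ε - meanCost ξ δ s) + θ * (ε - meanCost ξ δ s') = 0 := by
      rcases (sub_nonneg.2 (hsb'.trans hsb)).eq_or_lt with he | hlt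
      · exact ⟨0, le_rfl, zero_le_one, by linarith⟩
      · refine ⟨_, div_nonneg hsb hlt.le, (div_le_one hlt).2 (by linarith), ?_⟩
        field_simp
        ring
    have := mix_meanLoss_le_worstCaseLoss (ε := ε) hN ξ hγ hδ β s s' hθ0 hθ1 (by linarith)
    have e : M = (1 - θ) * meanLoss ξ β s + θ * meanLoss ξ β s' := by
      linear_combination (-(1 - θ)) * hsM - θ * hsM' + t * hθ
    rwa [e]

/-- Feasible objectives are nonnegative, so `ENNReal.ofReal` loses nothing and both inequalities
transfer to `EReal`. -/
lemma isLeast_worstCaseLoss (hε : 0 ≤ ε) :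
    IsLeast {v : EReal | ∃ (lam : ℝ) (r : Fin N → ℝ), (lam, r, β) ∈ programFeasible ξ γ δ ∧
        v = ((programObjective ε ((lam, r, β) : Decision N n k) : ℝ) : EReal)}
      ((worstCaseLoss ξ γ δ ⊤ ε β : ℝ≥0∞) : EReal) := by
  have hcoe : ∀ p ∈ programFeasible ξ γ δ, ((ENNReal.ofReal (programObjective ε p) : ℝ≥0∞) : EReal)
      = ((programObjective ε p : ℝ) : EReal) := fun p hp => by
    rw [EReal.coe_ennreal_ofReal, max_eq_left (programObjective_nonneg ξ γ δ hε hp)]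
  constructor
  · obtain ⟨lam, r, hp, hle⟩ := exists_optimal_multiplier hN ξ hγ hδ β hε
    refine ⟨lam, r, hp, ?_⟩
    rw [← hcoe _ hp, (worstCaseLoss_le_programObjective hN ξ hγ hδ hε hp).antisymm hle]
  · rintro _ ⟨lam, r, hp, rfl⟩
    rw [← hcoe _ hp]
    exact EReal.coe_ennreal_le_coe_ennreal_iff.2
      (worstCaseLoss_le_programObjective hN ξ hγ hδ hε hp)

end StrongDuality

/-! ### Joint minimisation over `β` and the multipliers. -/

theorem theorem1 {N n m : ℕ} (hN : 0 < N) (k : Fin m → ℕ) (ξ : Fin N → Datum n k)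
    (γ : Fin n → ℝ) (hγ : ∀ j, 0 < γ j) (δ : Fin m → ℝ) (hδ : ∀ ℓ, 0 < δ ℓ)
    (ε : ℝ) (hε : 0 ≤ ε) :
    -- for every `β`, the worst-case loss is the attained minimum over `(lam, r)`
    (∀ β : Coef n k,
      IsLeast {v : EReal | ∃ (lam : ℝ) (r : Fin N → ℝ),
          (lam, r, β) ∈ programFeasible ξ γ δ ∧
          v = ((programObjective ε ((lam, r, β) : Decision N n k) : ℝ) : EReal)}
        ((worstCaseLoss ξ γ δ ⊤ ε β : ℝ≥0∞) : EReal)) ∧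
    -- the two problems have the same optimal value
    (⨅ β : Coef n k, ((worstCaseLoss ξ γ δ ⊤ ε β : ℝ≥0∞) : EReal)) =
      (⨅ p ∈ programFeasible ξ γ δ, ((programObjective ε p : ℝ) : EReal)) ∧
    -- and the same optimal coefficients
    (∀ β : Coef n k,
      IsMinOn (worstCaseLoss ξ γ δ ⊤ ε) Set.univ β ↔
        ∃ (lam : ℝ) (r : Fin N → ℝ), (lam, r, β) ∈ programFeasible ξ γ δ ∧
          IsMinOn (programObjective ε) (programFeasible ξ γ δ) (lam, r, β)) ∧
    -- the program has finitely many constraints, and is convex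
    Finite (Fin N × CatSpace k) ∧
    ConvexOn ℝ Set.univ (programObjective ε : Decision N n k → ℝ) ∧
    (∀ (i : Fin N) (z : CatSpace k), ConvexOn ℝ Set.univ (fun p : Decision N n k =>
      logLoss p.2.2 (ξ i).1 z (ξ i).2.2 - p.1 * catDist δ z (ξ i).2.1 - p.2.1 i)) ∧
    (∀ j : Fin n, ConvexOn ℝ Set.univ (fun p : Decision N n k =>
      |(γ j)⁻¹ * p.2.2.2.1 j| - p.1)) ∧
    Convex ℝ (programFeasible ξ γ δ) ∧
    -- each log-loss constraint is a pair of exponential-cone constraints and a linear one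
    (∀ (i : Fin N) (z : CatSpace k) (p : Decision N n k),
      logLoss p.2.2 (ξ i).1 z (ξ i).2.2 - p.1 * catDist δ z (ξ i).2.1 ≤ p.2.1 i ↔
        ∃ u v : ℝ, ExpConeConstraint ξ δ i z p u v) ∧
    -- so the program is equivalent to a convex exponential-cone program
    Prod.fst '' conicFeasible ξ γ δ = programFeasible ξ γ δ ∧
    Convex ℝ (conicFeasible ξ γ δ) ∧
    (⨅ p ∈ programFeasible ξ γ δ, ((programObjective ε p : ℝ) : EReal)) =
      (⨅ q ∈ conicFeasible ξ γ δ, ((programObjective ε q.1 : ℝ) : EReal)) := by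
  have hleast := fun β => isLeast_worstCaseLoss hN ξ hγ hδ β hε
  have hle : ∀ p ∈ programFeasible ξ γ δ, ((worstCaseLoss ξ γ δ ⊤ ε p.2.2 : ℝ≥0∞) : EReal) ≤
      ((programObjective ε p : ℝ) : EReal) := fun p hp => (hleast p.2.2).2 ⟨p.1, p.2.1, hp, rfl⟩
  refine ⟨hleast, le_antisymm ?_ ?_, fun β => ⟨fun h => ?_, ?_⟩, inferInstance,
    programObjective_convexOn ε, fun i z => logLoss_constraint_convexOn _ z _ _ i,
    fun j => slope_constraint_convexOn _ j, convex_programFeasible ξ γ δ,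
    logLoss_constraint_iff ξ δ, image_fst_conicFeasible ξ γ δ, convex_conicFeasible ξ γ δ, ?_⟩
  · exact le_iInf₂ fun p hp => (iInf_le _ p.2.2).trans (hle p hp)
  · refine le_iInf fun β => ?_
    obtain ⟨lam, r, hp, he⟩ := (hleast β).1
    rw [he]
    exact iInf₂_le (lam, r, β) hp
  · obtain ⟨lam, r, hp, he⟩ := (hleast β).1
    refine ⟨lam, r, hp, fun p' hp' => ?_⟩
    have h1 : worstCaseLoss ξ γ δ ⊤ ε β ≤ worstCaseLoss ξ γ δ ⊤ ε p'.2.2 := h (Set.mem_univ _)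
    have h2 := (EReal.coe_ennreal_le_coe_ennreal_iff.2 h1).trans (hle p' hp')
    rw [he] at h2
    exact EReal.coe_le_coe_iff.1 h2
  · rintro ⟨lam, r, hp, hmin⟩ β' -
    obtain ⟨lam', r', hp', he'⟩ := (hleast β').1
    have h1 : programObjective ε (lam, r, β) ≤ programObjective ε (lam', r', β') := hmin hp'
    refine EReal.coe_ennreal_le_coe_ennreal_iff.1 ((hle _ hp).trans ?_)
    rw [he']
    exact EReal.coe_le_coe_iff.2 h1
  · rw [← image_fst_conicFeasible ξ γ δ]
    exact iInf_image
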